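/- Consider $J\ge 1$ items. Item $j$ has order-up-to level $Q_j\in\mathbb Z_{>0}$, Poisson demand of rate $\lambda_j>0$ and cost $b_j\ge 0$ per unit of unmet demand; a replenishment costs $A$ and takes a constant lead time $\tau\ge 0$. Let $\Lambda=\sum_j\lambda_j$, let $D_j(\tau)$ be Poisson with mean $\lambda_j\tau$, and let $\mathcal S=\{i\in\mathbb Z^J: i_j\le Q_j \text{ for all } j\}$ be the state space (a negative $i_j$ counts stockouts). A trigger set $\mathcal U\subseteq\mathcal S$ controls a Markov chain that starts at $Q=(Q_1,\dots,Q_J)$. In a state $i\notin\mathcal U$ (continue) it spends expected time $1/\Lambda$ at no cost and then moves to $i$ with one unit of item $j$ less, with probability $\lambda_j/\Lambda$. In a state $i\in\mathcal U$ (stop, replenish) it spends time $\tau$ at expected cost $$G(i)=A+\sum_j b_j\sum_{r\ge i_j}(r-i_j)\,P(D_j(\tau)=r)$$ and returns to $Q$. The long-run expected average cost per unit time of $\mathcal U$ is the limit, as $n\to\infty$, of the expected cost of the first $n$ visits divided by the expected duration of these visits. Call $\mathcal U$ admissible if $Q\notin\mathcal U$ and the expected number of demands until $\mathcal U$ is first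 entered from $Q$ is finite. Let $\alpha^*$ be the infimum of the long-run expected average costs over all admissible trigger sets. Assume $$\sum_j b_jQ_j\,P(D_j(\tau)\ge Q_j+1)\;\le\;A\;<\;\sum_j b_jQ_j .$$ Theorem 2. Every admissible trigger set has a long-run expected average cost. Let $\hat g(i)=\sum_j\lambda_j b_j\,P(D_j(\tau)\ge i_j)$. The policy $\mu_{\alpha^*}$ that continues in the states $i\in\mathcal S$ with $\hat g(i)\le\alpha^*$ and stops (replenishes) in the states $i\in\mathcal S$ with $\hat g(i)>\alpha^*$ is admissible and optimal: its long-run expected average cost per unit time equals $\alpha^*$, so that the infimum is attained. -/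

import Mathlib

open MeasureTheory ProbabilityTheory Filter Topology
open scoped ENNReal NNReal

/-- The data of a vending-machine replenishment system with `numItems` items: order-up-to levels
`Q j`, Poisson demand rates `rate j`, cost `stockoutCost j` per unit of unmet demand, cost
`fixedCost` per replenishment, and deterministic lead time `leadTime`. -/
structure VendingSystem where
  numItems : ℕ
  numItems_pos : 0 < numItems
  Q : Fin numItems → ℤ
  Q_pos : ∀ j, 0 < Q j
  rate : Fin numItems → ℝ
  rate_pos : ∀ j, 0 < rate j
  stockoutCost : Fin numItems → ℝ
  stockoutCost_nonneg : ∀ j, 0 ≤ stockoutCost j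
  fixedCost : ℝ
  leadTime : ℝ
  leadTime_nonneg : 0 ≤ leadTime

namespace VendingSystem

/-- A vector of inventory levels. A negative level counts the stockouts of the current cycle. -/
abbrev State (V : VendingSystem) : Type := Fin V.numItems → ℤ

/-- The state space: all integer vectors that lie below the order-up-to levels. -/
def stateSpace (V : VendingSystem) : Set V.State := {i | ∀ j, i j ≤ V.Q j}

/-- The total demand rate `Λ`. -/
noncomputable def totalRate (V : VendingSystem) : ℝ := ∑ j, V.rate j

theorem totalRate_pos (V : VendingSystem) : 0 < V.totalRate :=
  Finset.sum_pos (fun j _ => V.rate_pos j) ⟨⟨0, V.numItems_pos⟩, Finset.mem_univ _⟩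

/-- The law of the item asked for by one demand: item `j` with probability `p j = rate j / Λ`. -/
noncomputable def itemLaw (V : VendingSystem) : PMF (Fin V.numItems) :=
  PMF.ofFintype (fun j => ENNReal.ofReal (V.rate j / V.totalRate)) (by
    rw [← ENNReal.ofReal_sum_of_nonneg
      (fun j _ => div_nonneg (V.rate_pos j).le V.totalRate_pos.le), ← Finset.sum_div]
    change ENNReal.ofReal (V.totalRate / V.totalRate) = 1
    rw [div_self V.totalRate_pos.ne', ENNReal.ofReal_one])

/-- The law of an infinite sequence of independent draws from `itemLaw`; the `k`-th draw decides
the `k`-th transition of the uniformized chain (it is not used if the chain is then restocked). -/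
noncomputable def demandLaw (V : VendingSystem) : Measure (ℕ → Fin V.numItems) :=
  Measure.infinitePi (fun _ : ℕ => V.itemLaw.toMeasure)

/-- The law of the demand `D_j(τ)` for item `j` during the lead time: Poisson with mean
`rate j * leadTime`. -/
noncomputable def leadDemandLaw (V : VendingSystem) (j : Fin V.numItems) : Measure ℕ :=
  poissonMeasure (Real.toNNReal (V.rate j * V.leadTime))

/-- The tail probability `P(D_j(τ) ≥ x)`. -/
noncomputable def leadDemandTail (V : VendingSystem) (j : Fin V.numItems) (x : ℤ) : ℝ :=
  (V.leadDemandLaw j).real {r : ℕ | x ≤ (r : ℤ)}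

/-- The expected cost `G(i)` of stopping in state `i`:
`A + ∑ j, b j * ∑_{r ≥ i j} (r - i j) * P(D_j(τ) = r)`. -/
noncomputable def stopCost (V : VendingSystem) (i : V.State) : ℝ :=
  V.fixedCost + ∑ j, V.stockoutCost j *
    ∑' r : ℕ, if i j ≤ (r : ℤ) then
      ((r : ℝ) - (i j : ℝ)) * (V.leadDemandLaw j).real {r} else 0

/-- The function `ĝ(i) = ∑ j, rate j * b j * P(D_j(τ) ≥ i j)`. -/
noncomputable def gHat (V : VendingSystem) (i : V.State) : ℝ :=
  ∑ j, V.rate j * V.stockoutCost j * V.leadDemandTail j (i j)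

open Classical in
/-- The chain controlled by the trigger set `U`, along the demand sequence `ω`. It starts full;
it moves from a state of `U` to the full state (restocking), and from any other state to the state
with one unit less of the item that is asked for. -/
noncomputable def chain (V : VendingSystem) (U : Set V.State) (ω : ℕ → Fin V.numItems) :
    ℕ → V.State
  | 0 => V.Q
  | k + 1 =>
    if chain V U ω k ∈ U then V.Q
    else chain V U ω k - Pi.single (ω k) 1

open Classical in
/-- The expected cost incurred at a visit to state `i`: `G(i)` if a replenishment is triggered,
nothing otherwise. -/
noncomputable def visitCost (V : VendingSystem) (U : Set V.State) (i : V.State) : ℝ :=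
  if i ∈ U then V.stopCost i else 0

open Classical in
/-- The expected time spent at a visit to state `i`: the lead time if a replenishment is triggered,
the mean time `1 / Λ` until the next demand otherwise. -/
noncomputable def visitTime (V : VendingSystem) (U : Set V.State) (i : V.State) : ℝ :=
  if i ∈ U then V.leadTime else 1 / V.totalRate

/-- The expected cost of the first `n` visits of the controlled chain. -/
noncomputable def expectedCost (V : VendingSystem) (U : Set V.State) (n : ℕ) : ℝ :=
  ∫ ω, ∑ k ∈ Finset.range n, V.visitCost U (V.chain U ω k) ∂V.demandLaw

/-- The expected time taken by the first `n` visits of the controlled chain. -/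
noncomputable def expectedTime (V : VendingSystem) (U : Set V.State) (n : ℕ) : ℝ :=
  ∫ ω, ∑ k ∈ Finset.range n, V.visitTime U (V.chain U ω k) ∂V.demandLaw

/-- The trigger set `U` has long-run expected average cost `c` per unit time. -/
def HasAverageCost (V : VendingSystem) (U : Set V.State) (c : ℝ) : Prop :=
  Tendsto (fun n => V.expectedCost U n / V.expectedTime U n) atTop (𝓝 c)

/-- The number of demands until the trigger set is entered for the first time (`∞` if it never
is). -/
noncomputable def stepsToTrigger (V : VendingSystem) (U : Set V.State)
    (ω : ℕ → Fin V.numItems) : ℝ≥0∞ :=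
  ⨅ (k : ℕ) (_ : V.chain U ω k ∈ U), (k : ℝ≥0∞)

/-- The admissible trigger sets: no replenishment is triggered in the full state, and the expected
length of a replenishment cycle is finite, so that the controlled chain is ergodic. -/
structure Admissible (V : VendingSystem) (U : Set V.State) : Prop where
  subset_stateSpace : U ⊆ V.stateSpace
  full_notMem : V.Q ∉ U
  lintegral_steps_lt_top : ∫⁻ ω, V.stepsToTrigger U ω ∂V.demandLaw < ∞

/-- The optimal cost `α*`: the infimum of the average costs of all admissible trigger sets. -/
noncomputable def optimalCost (V : VendingSystem) : ℝ :=
  sInf {c | ∃ U, V.Admissible U ∧ V.HasAverageCost U c}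

/-- The trigger set of the policy `μ_α`, which continues in the states `i` with `ĝ(i) ≤ α` and
stops in the states `i` with `ĝ(i) > α`. -/
def onlineTriggerSet (V : VendingSystem) (α : ℝ) : Set V.State :=
  {i | i ∈ V.stateSpace ∧ α < V.gHat i}

/-- The fixed cost `A_min = ∑ j, b j * Q j * P(D_j(τ) ≥ Q j + 1)`, below which it would pay to
replenish a full machine. -/
noncomputable def minFixedCost (V : VendingSystem) : ℝ :=
  ∑ j, V.stockoutCost j * (V.Q j : ℝ) * V.leadDemandTail j (V.Q j + 1)

/-- The stockout cost `∑ j, b j * Q j` of a full load, at and above which no replenishment is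
worth its fixed cost. -/
noncomputable def fullLoadValue (V : VendingSystem) : ℝ :=
  ∑ j, V.stockoutCost j * (V.Q j : ℝ)

end VendingSystem

/-! By renewal theory the average cost of an admissible `U` is the ratio C(U)/T(U) of expected cost
and duration of one cycle. The expected increase of `stopCost` at one demand is `gHat / totalRate`,
so Dynkin's formula rewrites the expected terminal cost G as an initial constant plus a running
cost: C(U) - αT(U) is a constant independent of `U` plus Λ⁻¹ times the expected sum of `gHat - α`
over the states in which `U` continues. Every demand weakly increases `gHat`. Hence stopping as soon
as `gHat` exceeds α minimizes this sum: all earlier terms are nonpositive and all later ones would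
be positive (`excess_onlineTriggerSet_le`). The bounds on A place α* in the interval [`gHat Q`,
`gHatMax`). The lower bound on A gives G(Q) ≥ τ `gHat Q`, so no ratio is below `gHat Q` and the
α*-rule continues in the full state. The upper bound on A makes the policy that waits until
everything is sold out cheaper than `gHatMax`, so the α*-rule stops at the latest in a sold-out
state and is admissible. For attainment, take α slightly above α*. Some policy has C - αT < 0, hence
so does the α-rule, whose cycle is no longer than the sell-out cycle. Comparing it with the α*-rule
at level α* bounds C - α*T of the latter by (α - α*) times the sell-out cycle time, which tends to
0. -/

section Poisson

/-! ### Poisson tails and expected shortages. -/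

theorem poissonMeasure_real_succ (r : ℝ≥0) (n : ℕ) :
    ((n : ℝ) + 1) * (poissonMeasure r).real {n + 1} = r * (poissonMeasure r).real {n} := by
  rw [poissonMeasure_real_singleton, poissonMeasure_real_singleton, Nat.factorial_succ, pow_succ]
  push_cast
  have h1 : ((n : ℝ) + 1) ≠ 0 := by positivity
  have h2 : (n.factorial : ℝ) ≠ 0 := by positivity
  field_simp

theorem hasSum_poissonMeasure_real (r : ℝ≥0) :
    HasSum (fun n : ℕ => (poissonMeasure r).real {n}) 1 := by
  simpa only [poissonMeasure_real_singleton] using hasSum_one_poissonMeasure r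

theorem hasSum_mean_poissonMeasure (r : ℝ≥0) :
    HasSum (fun n : ℕ => (n : ℝ) * (poissonMeasure r).real {n}) r := by
  rw [← hasSum_nat_add_iff' 1]
  simpa [poissonMeasure_real_succ] using (hasSum_poissonMeasure_real r).mul_left (r : ℝ)

theorem hasSum_poissonMeasure_tail (r : ℝ≥0) (x : ℤ) :
    HasSum (fun n : ℕ => if x ≤ (n : ℤ) then (poissonMeasure r).real {n} else 0)
      ((poissonMeasure r).real {n : ℕ | x ≤ (n : ℤ)}) := by
  have hint : Integrable ({n : ℕ | x ≤ (n : ℤ)}.indicator (fun _ => (1 : ℝ)))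
      (poissonMeasure r) := (integrable_const 1).indicator .of_discrete
  have h := hasSum_integral_poissonMeasure hint
  rw [integral_indicator_const (1 : ℝ) .of_discrete, smul_eq_mul, mul_one] at h
  refine h.congr_fun ?_
  intro n
  by_cases hn : x ≤ (n : ℤ) <;> simp [hn, poissonMeasure_real_singleton]

/-- The expected shortage `E (D - x)⁺` for a Poisson variable `D` with mean `r`. -/
noncomputable def poissonShortage (r : ℝ≥0) (x : ℤ) : ℝ :=
  ∑' n : ℕ, if x ≤ (n : ℤ) then ((n : ℝ) - (x : ℝ)) * (poissonMeasure r).real {n} else 0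

theorem hasSum_poissonShortage (r : ℝ≥0) (x : ℤ) :
    HasSum (fun n : ℕ => if x ≤ (n : ℤ) then
      ((n : ℝ) - (x : ℝ)) * (poissonMeasure r).real {n} else 0) (poissonShortage r x) := by
  refine Summable.hasSum (Summable.of_norm_bounded (g := fun n : ℕ =>
    (n : ℝ) * (poissonMeasure r).real {n} + |(x : ℝ)| * (poissonMeasure r).real {n})
    ((hasSum_mean_poissonMeasure r).summable.add
      ((hasSum_poissonMeasure_real r).summable.mul_left _)) fun n => ?_)
  have hp : 0 ≤ (poissonMeasure r).real {n} := measureReal_nonneg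
  split_ifs
  · rw [norm_mul, Real.norm_eq_abs, Real.norm_eq_abs, abs_of_nonneg hp, ← add_mul]
    refine mul_le_mul_of_nonneg_right ((abs_sub _ _).trans ?_) hp
    simp
  · rw [norm_zero]
    positivity

theorem poissonShortage_nonneg (r : ℝ≥0) (x : ℤ) : 0 ≤ poissonShortage r x := by
  refine (hasSum_poissonShortage r x).nonneg fun n => ?_
  split_ifs with h
  · have : (x : ℝ) ≤ n := by exact_mod_cast h
    exact mul_nonneg (sub_nonneg.2 this) measureReal_nonneg
  · exact le_rfl

/-- Pointwise, (D - x + 1)⁺ = (D - x)⁺ + 1{D ≥ x}. This is the source of `gHat` as the drift of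
`stopCost`. -/
theorem poissonShortage_sub_one (r : ℝ≥0) (x : ℤ) :
    poissonShortage r (x - 1) =
      poissonShortage r x + (poissonMeasure r).real {n : ℕ | x ≤ (n : ℤ)} := by
  refine (hasSum_poissonShortage r (x - 1)).unique
    (((hasSum_poissonShortage r x).add (hasSum_poissonMeasure_tail r x)).congr_fun fun n => ?_)
  push_cast
  rcases lt_trichotomy (x - 1) (n : ℤ) with h | h | h
  · rw [if_pos h.le, if_pos (by omega), if_pos (by omega)]
    ring
  · have : (x : ℝ) - 1 = n := by exact_mod_cast h
    rw [if_pos h.le, if_neg (by omega), if_neg (by omega), this]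
    simp
  · rw [if_neg (by omega), if_neg (by omega), if_neg (by omega)]
    simp

theorem poissonMeasure_tail_of_nonpos (r : ℝ≥0) {x : ℤ} (hx : x ≤ 0) :
    (poissonMeasure r).real {n : ℕ | x ≤ (n : ℤ)} = 1 := by
  have : {n : ℕ | x ≤ (n : ℤ)} = Set.univ := by
    ext n
    simp only [Set.mem_ofPred_eq, Set.mem_univ, iff_true]
    omega
  rw [this, probReal_univ]

theorem poissonMeasure_tail_succ (r : ℝ≥0) (n : ℕ) :
    (poissonMeasure r).real {k : ℕ | (n : ℤ) ≤ (k : ℤ)} =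
      (poissonMeasure r).real {n} + (poissonMeasure r).real {k : ℕ | (n : ℤ) + 1 ≤ (k : ℤ)} := by
  have : {k : ℕ | (n : ℤ) ≤ (k : ℤ)} = {n} ∪ {k : ℕ | (n : ℤ) + 1 ≤ (k : ℤ)} := by
    ext k
    simp only [Set.mem_ofPred_eq, Set.mem_union, Set.mem_singleton_iff]
    omega
  rw [this, measureReal_union _ .of_discrete]
  rw [Set.disjoint_singleton_left]
  simp

theorem poissonShortage_zero (r : ℝ≥0) : poissonShortage r 0 = r :=
  (hasSum_poissonShortage r 0).unique (by simpa using hasSum_mean_poissonMeasure r)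

theorem poissonShortage_of_nonpos (r : ℝ≥0) {x : ℤ} (hx : x ≤ 0) :
    poissonShortage r x = r - x := by
  induction x, hx using Int.leInductionDown with
  | base => simp [poissonShortage_zero]
  | pred x hx ih =>
    rw [poissonShortage_sub_one, ih, poissonMeasure_tail_of_nonpos r hx]
    push_cast
    ring

/-- Size biasing: E[D; D ≥ n + 1] = r P(D ≥ n). The shifted tail is the one that occurs in
`minFixedCost`. -/
theorem poissonShortage_natCast (r : ℝ≥0) (n : ℕ) :
    poissonShortage r n = r * (poissonMeasure r).real {k : ℕ | (n : ℤ) ≤ (k : ℤ)} -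
      n * (poissonMeasure r).real {k : ℕ | (n : ℤ) + 1 ≤ (k : ℤ)} := by
  induction n with
  | zero =>
    rw [Nat.cast_zero, Nat.cast_zero, poissonShortage_zero,
      poissonMeasure_tail_of_nonpos r (le_refl 0)]
    ring
  | succ n ih =>
    have h := poissonShortage_sub_one r ((n : ℤ) + 1)
    rw [add_sub_cancel_right, ih] at h
    have h1 := poissonMeasure_tail_succ r n
    have h2 := poissonMeasure_tail_succ r (n + 1)
    have h3 := poissonMeasure_real_succ r n
    push_cast at h1 h2 ⊢
    linear_combination r * h1 - h - (n + 1) * h2 - h3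

end Poisson

/-! ### Cesàro limits of renewal sequences. -/

section Renewal

/-- Write n r(n) as the sum of r(n) over k < n; each term tends to 0 and is dominated by r(k). -/
theorem tendsto_natCast_mul_of_antitone {r : ℕ → ℝ} (hanti : Antitone r) (hpos : ∀ n, 0 ≤ r n)
    (hsum : Summable r) : Tendsto (fun n : ℕ => (n : ℝ) * r n) atTop (𝓝 0) := by
  have h := tendsto_tsum_of_dominated_convergence (𝓕 := atTop)
    (f := fun n k : ℕ => if k < n then r n else 0) (g := fun _ => (0 : ℝ)) hsum
    (fun k => by
      refine squeeze_zero (fun n => ?_) (fun n => ?_) hsum.tendsto_atTop_zero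
      · split_ifs
        exacts [hpos n, le_rfl]
      · split_ifs
        exacts [le_rfl, hpos n])
    (Eventually.of_forall fun n k => by
      split_ifs with hk
      · rw [Real.norm_of_nonneg (hpos n)]
        exact hanti hk.le
      · rw [norm_zero]
        exact hpos k)
  rw [tsum_zero] at h
  refine h.congr fun n => ?_
  rw [tsum_eq_sum (s := Finset.range n) fun k hk => if_neg (by simpa using hk),
    Finset.sum_congr rfl fun k hk => if_pos (Finset.mem_range.1 hk)]
  simp

theorem sum_range_convolution (u f : ℕ → ℝ) (n : ℕ) :
    ∑ t ∈ Finset.range n, ∑ s ∈ Finset.range (t + 1), u s * f (t - s) =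
      ∑ s ∈ Finset.range n, u s * ∑ m ∈ Finset.range (n - s), f m := by
  induction n with
  | zero => simp
  | succ n ih =>
    have h : ∀ s ∈ Finset.range (n + 1), u s * ∑ m ∈ Finset.range (n + 1 - s), f m =
        u s * ∑ m ∈ Finset.range (n - s), f m + u s * f (n - s) := by
      intro s hs
      rw [Nat.succ_sub (Nat.lt_succ_iff.1 (Finset.mem_range.1 hs)), Finset.sum_range_succ, mul_add]
    rw [Finset.sum_range_succ, ih, Finset.sum_congr rfl h, Finset.sum_add_distrib,
      Finset.sum_range_succ (fun s => u s * ∑ m ∈ Finset.range (n - s), f m)]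
    simp

/-- The difference is a Cesàro mean of the errors of the partial sums of `f`, weighted by `u ≤ 1`.
Convergence of the means of `u` is not presupposed. -/
theorem tendsto_convolution_sub {u f : ℕ → ℝ} {F : ℝ} (hu0 : ∀ s, 0 ≤ u s) (hu1 : ∀ s, u s ≤ 1)
    (hf : HasSum f F) :
    Tendsto (fun n : ℕ => (∑ t ∈ Finset.range n, ∑ s ∈ Finset.range (t + 1), u s * f (t - s)) / n -
      F * ((∑ s ∈ Finset.range n, u s) / n)) atTop (𝓝 0) := by
  have hlim : Tendsto (fun k : ℕ => |∑ m ∈ Finset.range (k + 1), f m - F|) atTop (𝓝 0) := by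
    have := ((hf.tendsto_sum_nat.comp (tendsto_add_atTop_nat 1)).sub_const F).abs
    simpa using this
  refine squeeze_zero_norm (fun n => ?_) hlim.cesaro
  have heq : (∑ t ∈ Finset.range n, ∑ s ∈ Finset.range (t + 1), u s * f (t - s)) / n -
      F * ((∑ s ∈ Finset.range n, u s) / n) =
      (n : ℝ)⁻¹ * ∑ s ∈ Finset.range n, u s * (∑ m ∈ Finset.range (n - s), f m - F) := by
    simp only [sum_range_convolution, mul_sub, Finset.sum_sub_distrib, ← Finset.sum_mul]
    ring
  rw [heq, norm_mul, Real.norm_of_nonneg (by positivity)]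
  refine mul_le_mul_of_nonneg_left ?_ (by positivity)
  -- Reflection turns the upper limit `n - s` into `k + 1`, so that the summands of the bound no
  -- longer depend on `n`.
  rw [← Finset.sum_range_reflect]
  refine (norm_sum_le _ _).trans (Finset.sum_le_sum fun k hk => ?_)
  have hk' := Finset.mem_range.1 hk
  rw [show n - (n - 1 - k) = k + 1 by omega, norm_mul, Real.norm_of_nonneg (hu0 _)]
  exact mul_le_of_le_one_left (norm_nonneg _) (hu1 _)

/-- The elementary renewal theorem for rewards: `u` is a renewal sequence and `r m` is the
probability that a cycle has more than `m` steps. -/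
theorem tendsto_renewal_reward {u r f : ℕ → ℝ} {M F : ℝ} (hu0 : ∀ s, 0 ≤ u s) (hu1 : ∀ s, u s ≤ 1)
    (hr : HasSum r M) (hM : M ≠ 0)
    (hur : ∀ t, ∑ s ∈ Finset.range (t + 1), u s * r (t - s) = 1) (hf : HasSum f F) :
    Tendsto (fun n : ℕ => (∑ t ∈ Finset.range n, ∑ s ∈ Finset.range (t + 1), u s * f (t - s)) / n)
      atTop (𝓝 (F / M)) := by
  -- For `f = r` the convolution is identically 1, which forces the mean renewal frequency;
  -- averaging makes aperiodicity unnecessary.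
  have h1 : Tendsto (fun n : ℕ => (∑ s ∈ Finset.range n, u s) / n) atTop (𝓝 (1 / M)) := by
    have h := (tendsto_convolution_sub hu0 hu1 hr).const_sub 1 |>.div_const M
    rw [sub_zero] at h
    refine h.congr' ?_
    filter_upwards [eventually_ne_atTop 0] with n hn
    have hn' : (n : ℝ) ≠ 0 := Nat.cast_ne_zero.2 hn
    simp only [hur, Finset.sum_const, Finset.card_range, nsmul_eq_mul, mul_one]
    field_simp
    ring
  have h2 := (tendsto_convolution_sub hu0 hu1 hf).add (h1.const_mul F)
  rw [zero_add, mul_one_div] at h2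
  exact h2.congr fun n => sub_add_cancel _ _

end Renewal

namespace VendingSystem

/-! ### Killed and restarted transition operators, Dynkin's formula, renewal decomposition. -/

section Operators

/-- The expected value of `φ` after one demand in state `i`. -/
noncomputable def demandStep (V : VendingSystem) (φ : V.State → ℝ) (i : V.State) : ℝ :=
  ∑ j, V.rate j / V.totalRate * φ (i - Pi.single j 1)

theorem sum_rate_div_totalRate (V : VendingSystem) : ∑ j, V.rate j / V.totalRate = 1 := by
  rw [← Finset.sum_div]
  exact div_self V.totalRate_pos.ne'

theorem rate_div_totalRate_pos (V : VendingSystem) (j : Fin V.numItems) :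
    0 < V.rate j / V.totalRate := div_pos (V.rate_pos j) V.totalRate_pos

theorem demandStep_mono {V : VendingSystem} {φ ψ : V.State → ℝ} {i : V.State}
    (h : ∀ j, φ (i - Pi.single j 1) ≤ ψ (i - Pi.single j 1)) :
    V.demandStep φ i ≤ V.demandStep ψ i :=
  Finset.sum_le_sum fun j _ => mul_le_mul_of_nonneg_left (h j) (V.rate_div_totalRate_pos j).le

theorem demandStep_const (V : VendingSystem) (c : ℝ) (i : V.State) :
    V.demandStep (fun _ => c) i = c := by
  rw [demandStep, ← Finset.sum_mul, sum_rate_div_totalRate, one_mul]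

theorem demandStep_add (V : VendingSystem) (φ ψ : V.State → ℝ) (i : V.State) :
    V.demandStep (φ + ψ) i = V.demandStep φ i + V.demandStep ψ i := by
  simp [demandStep, mul_add, Finset.sum_add_distrib]

theorem demandStep_smul (V : VendingSystem) (c : ℝ) (φ : V.State → ℝ) (i : V.State) :
    V.demandStep (c • φ) i = c * V.demandStep φ i := by
  simp only [demandStep, Finset.mul_sum, Pi.smul_apply, smul_eq_mul]
  exact Finset.sum_congr rfl fun j _ => by ring

/-- The expected increase of `φ` at the next demand. -/
noncomputable def drift (V : VendingSystem) (φ : V.State → ℝ) (i : V.State) : ℝ :=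
  V.demandStep φ i - φ i

open Classical in
/-- The transition operator of the chain that is killed when it leaves a state of `U`. -/
noncomputable def killedOp (V : VendingSystem) (U : Set V.State) :
    (V.State → ℝ) →ₗ[ℝ] (V.State → ℝ) where
  toFun φ i := if i ∈ U then 0 else V.demandStep φ i
  map_add' φ ψ := by
    ext i
    by_cases h : i ∈ U <;> simp [h, demandStep_add]
  map_smul' c φ := by
    ext i
    by_cases h : i ∈ U <;> simp [h, demandStep_smul]

open Classical in
/-- The transition operator of the controlled chain. -/
noncomputable def chainOp (V : VendingSystem) (U : Set V.State) (φ : V.State → ℝ) :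
    V.State → ℝ :=
  fun i => if i ∈ U then φ V.Q else V.demandStep φ i

variable {V : VendingSystem} {U : Set V.State}

theorem killedOp_of_mem (φ : V.State → ℝ) {i : V.State} (h : i ∈ U) : V.killedOp U φ i = 0 :=
  if_pos h

theorem killedOp_of_notMem (φ : V.State → ℝ) {i : V.State} (h : i ∉ U) :
    V.killedOp U φ i = V.demandStep φ i := if_neg h

theorem chainOp_of_mem (φ : V.State → ℝ) {i : V.State} (h : i ∈ U) : V.chainOp U φ i = φ V.Q :=
  if_pos h

theorem chainOp_of_notMem (φ : V.State → ℝ) {i : V.State} (h : i ∉ U) :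
    V.chainOp U φ i = V.demandStep φ i := if_neg h

theorem killedOp_mono {φ ψ : V.State → ℝ} (h : φ ≤ ψ) : V.killedOp U φ ≤ V.killedOp U ψ := by
  intro i
  by_cases hi : i ∈ U
  · rw [killedOp_of_mem _ hi, killedOp_of_mem _ hi]
  · rw [killedOp_of_notMem _ hi, killedOp_of_notMem _ hi]
    exact demandStep_mono fun j => h _

theorem killedOp_pow_succ (n : ℕ) (φ : V.State → ℝ) :
    (V.killedOp U ^ (n + 1)) φ = (V.killedOp U ^ n) (V.killedOp U φ) := by
  rw [pow_succ, Module.End.mul_apply]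

theorem killedOp_pow_succ' (n : ℕ) (φ : V.State → ℝ) :
    (V.killedOp U ^ (n + 1)) φ = V.killedOp U ((V.killedOp U ^ n) φ) := by
  rw [pow_succ', Module.End.mul_apply]

theorem killedOp_pow_mono {φ ψ : V.State → ℝ} (h : φ ≤ ψ) (n : ℕ) :
    (V.killedOp U ^ n) φ ≤ (V.killedOp U ^ n) ψ := by
  induction n with
  | zero => simpa using h
  | succ n ih =>
    rw [killedOp_pow_succ', killedOp_pow_succ']
    exact killedOp_mono ih

theorem killedOp_pow_nonneg {φ : V.State → ℝ} (h : 0 ≤ φ) (n : ℕ) :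
    0 ≤ (V.killedOp U ^ n) φ := by
  simpa using killedOp_pow_mono (U := U) h n

theorem killedOp_one : V.killedOp U 1 = Uᶜ.indicator 1 := by
  ext i
  by_cases hi : i ∈ U
  · rw [killedOp_of_mem _ hi, Set.indicator_of_notMem (by simpa using hi)]
  · rw [killedOp_of_notMem _ hi, Set.indicator_of_mem (by simpa using hi)]
    exact V.demandStep_const 1 i

/-- The probability that, started in the full state, the chain visits no state of `U` before
time `n`. -/
noncomputable def survival (V : VendingSystem) (U : Set V.State) (n : ℕ) : ℝ :=
  (V.killedOp U ^ n) 1 V.Q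

theorem survival_zero : V.survival U 0 = 1 := rfl

theorem survival_succ (n : ℕ) :
    V.survival U (n + 1) = (V.killedOp U ^ n) (Uᶜ.indicator 1) V.Q := by
  rw [survival, killedOp_pow_succ, killedOp_one]

theorem survival_nonneg (n : ℕ) : 0 ≤ V.survival U n :=
  killedOp_pow_nonneg (fun _ => zero_le_one) n V.Q

theorem survival_antitone : Antitone (V.survival U) := by
  refine antitone_nat_of_succ_le fun n => ?_
  rw [survival_succ]
  exact killedOp_pow_mono (Set.indicator_le_self' fun _ _ => zero_le_one) n V.Q

theorem killedOp_anti {U' : Set V.State} (hU : U ⊆ U') {φ : V.State → ℝ} (hφ : 0 ≤ φ) :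
    V.killedOp U' φ ≤ V.killedOp U φ := by
  intro i
  by_cases hi : i ∈ U'
  · rw [killedOp_of_mem _ hi]
    by_cases hi' : i ∈ U
    · rw [killedOp_of_mem _ hi']
    · rw [killedOp_of_notMem _ hi']
      exact Finset.sum_nonneg fun j _ => mul_nonneg (V.rate_div_totalRate_pos j).le (hφ _)
  · rw [killedOp_of_notMem _ hi, killedOp_of_notMem _ fun h => hi (hU h)]

theorem survival_anti {U' : Set V.State} (hU : U ⊆ U') (n : ℕ) :
    V.survival U' n ≤ V.survival U n := by
  suffices h : (V.killedOp U' ^ n) 1 ≤ (V.killedOp U ^ n) 1 from h V.Q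
  induction n with
  | zero => simp
  | succ n ih =>
    rw [killedOp_pow_succ', killedOp_pow_succ']
    exact (killedOp_mono ih).trans
      (killedOp_anti hU (killedOp_pow_nonneg (fun _ => zero_le_one) n))

theorem abs_killedOp_pow_le {ψ : V.State → ℝ} {B : ℝ} (hB : ∀ i ∈ Uᶜ, |ψ i| ≤ B) (n : ℕ) :
    |(V.killedOp U ^ n) (Uᶜ.indicator ψ) V.Q| ≤ B * V.survival U (n + 1) := by
  have hsm : B * V.survival U (n + 1) = (V.killedOp U ^ n) (B • Uᶜ.indicator 1) V.Q := by
    rw [map_smul, Pi.smul_apply, smul_eq_mul, survival_succ]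
  have hle : ∀ i, |Uᶜ.indicator ψ i| ≤ (B • Uᶜ.indicator (1 : V.State → ℝ)) i := by
    intro i
    by_cases hi : i ∈ Uᶜ
    · simpa [Set.indicator_of_mem hi] using hB i hi
    · simp [Set.indicator_of_notMem hi]
  rw [abs_le, hsm]
  constructor
  · rw [← Pi.neg_apply, ← map_neg]
    exact killedOp_pow_mono (fun i => (abs_le.1 (hle i)).1) n V.Q
  · exact killedOp_pow_mono (fun i => (abs_le.1 (hle i)).2) n V.Q

theorem summable_killedOp_pow (hU : Summable (V.survival U)) {ψ : V.State → ℝ} {B : ℝ}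
    (hB : ∀ i ∈ Uᶜ, |ψ i| ≤ B) :
    Summable fun n => (V.killedOp U ^ n) (Uᶜ.indicator ψ) V.Q :=
  Summable.of_norm_bounded (((summable_nat_add_iff 1).2 hU).mul_left B) (abs_killedOp_pow_le hB)

/-- On paths that survive `n` steps, `φ` has moved by at most `n * B`. This covers `stopCost`, which
may be unbounded but has bounded increments. -/
theorem abs_killedOp_pow_le_of_lipschitz {φ : V.State → ℝ} {B : ℝ}
    (hB : ∀ i j, |φ (i - Pi.single j 1) - φ i| ≤ B) (n : ℕ) (i : V.State) :
    |(V.killedOp U ^ n) φ i| ≤ (|φ i| + n * B) * (V.killedOp U ^ n) 1 i := by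
  induction n generalizing i with
  | zero => simp
  | succ n ih =>
    have h1 : 0 ≤ (V.killedOp U ^ n) 1 := killedOp_pow_nonneg (fun _ => zero_le_one) n
    rw [killedOp_pow_succ', killedOp_pow_succ']
    by_cases hi : i ∈ U
    · simp [killedOp_of_mem _ hi]
    · rw [killedOp_of_notMem _ hi, killedOp_of_notMem _ hi, demandStep, demandStep,
        Finset.mul_sum]
      refine (Finset.abs_sum_le_sum_abs _ _).trans (Finset.sum_le_sum fun j _ => ?_)
      rw [abs_mul, abs_of_pos (V.rate_div_totalRate_pos j), mul_left_comm]
      refine mul_le_mul_of_nonneg_left ((ih _).trans ?_) (V.rate_div_totalRate_pos j).le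
      refine mul_le_mul_of_nonneg_right ?_ (h1 _)
      have h2 := abs_sub_abs_le_abs_sub (φ (i - Pi.single j 1)) (φ i)
      have h3 := hB i j
      push_cast
      linarith

/-- The boundary term in Dynkin's formula vanishes: linear growth of `φ` is beaten because `n *
survival n` tends to 0. -/
theorem tendsto_killedOp_pow (hU : Summable (V.survival U)) {φ : V.State → ℝ} {B : ℝ}
    (hB : ∀ i j, |φ (i - Pi.single j 1) - φ i| ≤ B) :
    Tendsto (fun n => (V.killedOp U ^ n) φ V.Q) atTop (𝓝 0) := by
  refine squeeze_zero_norm (fun n => abs_killedOp_pow_le_of_lipschitz hB n V.Q) ?_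
  have h := (hU.tendsto_atTop_zero.const_mul |φ V.Q|).add
    ((tendsto_natCast_mul_of_antitone survival_antitone survival_nonneg hU).const_mul B)
  simp only [mul_zero, add_zero] at h
  refine h.congr fun n => ?_
  change _ = (|φ V.Q| + n * B) * V.survival U n
  ring

theorem abs_drift_le {φ : V.State → ℝ} {B : ℝ}
    (hB : ∀ i j, |φ (i - Pi.single j 1) - φ i| ≤ B) (i : V.State) : |V.drift φ i| ≤ B := by
  have h : V.drift φ i = V.demandStep (fun k => φ k - φ i) i := by
    rw [drift, demandStep, demandStep]
    simp only [mul_sub, Finset.sum_sub_distrib, ← Finset.sum_mul, sum_rate_div_totalRate, one_mul]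
  rw [h, abs_le]
  constructor
  · rw [← V.demandStep_const (-B) i]
    exact demandStep_mono fun j => (abs_le.1 (hB i j)).1
  · conv_rhs => rw [← V.demandStep_const B i]
    exact demandStep_mono fun j => (abs_le.1 (hB i j)).2

theorem indicator_eq_sub_killedOp_add (φ : V.State → ℝ) :
    U.indicator φ = φ - V.killedOp U φ + Uᶜ.indicator (V.drift φ) := by
  ext i
  by_cases hi : i ∈ U
  · simp [hi, killedOp_of_mem]
  · simp [hi, killedOp_of_notMem, drift]

/-- Dynkin's formula for the first cycle. -/
theorem sum_killedOp_pow_indicator (φ : V.State → ℝ) (n : ℕ) :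
    ∑ m ∈ Finset.range n, (V.killedOp U ^ m) (U.indicator φ) V.Q =
      φ V.Q - (V.killedOp U ^ n) φ V.Q +
        ∑ m ∈ Finset.range n, (V.killedOp U ^ m) (Uᶜ.indicator (V.drift φ)) V.Q := by
  induction n with
  | zero => simp
  | succ n ih =>
    rw [Finset.sum_range_succ, Finset.sum_range_succ, ih, indicator_eq_sub_killedOp_add φ,
      killedOp_pow_succ]
    simp only [map_add, map_sub, Pi.add_apply, Pi.sub_apply]
    ring

theorem tendsto_sum_killedOp_pow_indicator (hU : Summable (V.survival U)) {φ : V.State → ℝ}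
    {B : ℝ} (hB : ∀ i j, |φ (i - Pi.single j 1) - φ i| ≤ B) :
    Tendsto (fun n => ∑ m ∈ Finset.range n, (V.killedOp U ^ m) (U.indicator φ) V.Q) atTop
      (𝓝 (φ V.Q + ∑' m, (V.killedOp U ^ m) (Uᶜ.indicator (V.drift φ)) V.Q)) := by
  have h := ((tendsto_killedOp_pow hU hB).const_sub (φ V.Q)).add
    (summable_killedOp_pow hU (fun i _ => abs_drift_le hB i)).hasSum.tendsto_sum_nat
  rw [sub_zero] at h
  exact h.congr fun n => (sum_killedOp_pow_indicator φ n).symm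

/-- Restocking is killing followed by a restart at `Q`, a rank-one perturbation; iterating it yields
the renewal decomposition. -/
theorem chainOp_eq (φ : V.State → ℝ) :
    V.chainOp U φ = V.killedOp U φ + φ V.Q • U.indicator 1 := by
  ext i
  by_cases hi : i ∈ U
  · simp [hi, killedOp_of_mem, chainOp_of_mem]
  · simp [hi, killedOp_of_notMem, chainOp_of_notMem]

theorem chainOp_add (φ ψ : V.State → ℝ) :
    V.chainOp U (φ + ψ) = V.chainOp U φ + V.chainOp U ψ := by
  simp only [chainOp_eq, map_add, Pi.add_apply, add_smul]
  abel

theorem chainOp_smul (c : ℝ) (φ : V.State → ℝ) :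
    V.chainOp U (c • φ) = c • V.chainOp U φ := by
  simp only [chainOp_eq, map_smul, Pi.smul_apply, smul_add, smul_eq_mul, mul_smul]

theorem chainOp_iterate_add (n : ℕ) (φ ψ : V.State → ℝ) :
    (V.chainOp U)^[n] (φ + ψ) = (V.chainOp U)^[n] φ + (V.chainOp U)^[n] ψ := by
  induction n with
  | zero => rfl
  | succ n ih => simp only [Function.iterate_succ_apply', ih, chainOp_add]

theorem chainOp_iterate_smul (n : ℕ) (c : ℝ) (φ : V.State → ℝ) :
    (V.chainOp U)^[n] (c • φ) = c • (V.chainOp U)^[n] φ := by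
  induction n with
  | zero => rfl
  | succ n ih => simp only [Function.iterate_succ_apply', ih, chainOp_smul]

theorem chainOp_iterate_one (n : ℕ) : (V.chainOp U)^[n] 1 = 1 := by
  refine Function.iterate_fixed ?_ n
  ext i
  by_cases hi : i ∈ U
  · rw [chainOp_of_mem _ hi]
    rfl
  · rw [chainOp_of_notMem _ hi]
    exact V.demandStep_const 1 i

theorem chainOp_iterate_mono {φ ψ : V.State → ℝ} (h : φ ≤ ψ) (n : ℕ) :
    (V.chainOp U)^[n] φ ≤ (V.chainOp U)^[n] ψ := by
  refine Monotone.iterate (f := V.chainOp U) (fun φ ψ h i => ?_) n h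
  by_cases hi : i ∈ U
  · rw [chainOp_of_mem _ hi, chainOp_of_mem _ hi]
    exact h _
  · rw [chainOp_of_notMem _ hi, chainOp_of_notMem _ hi]
    exact demandStep_mono fun j => h _

/-- The probability that a cycle of the controlled chain starts at time `n`. -/
noncomputable def renewalProb (V : VendingSystem) (U : Set V.State) : ℕ → ℝ
  | 0 => 1
  | n + 1 => (V.chainOp U)^[n] (U.indicator 1) V.Q

theorem renewalProb_nonneg (n : ℕ) : 0 ≤ V.renewalProb U n := by
  cases n with
  | zero => exact zero_le_one
  | succ n =>
    have h := chainOp_iterate_mono (U := U) (φ := (0 : ℝ) • 1) (ψ := U.indicator 1)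
      (by
        rw [zero_smul]
        exact fun i => Set.indicator_nonneg (fun _ _ => zero_le_one) i) n V.Q
    rw [chainOp_iterate_smul, zero_smul] at h
    exact h

theorem renewalProb_le_one (n : ℕ) : V.renewalProb U n ≤ 1 := by
  cases n with
  | zero => exact le_rfl
  | succ n =>
    have h := chainOp_iterate_mono (U := U) (φ := U.indicator 1) (ψ := 1)
      (Set.indicator_le_self' fun _ _ => zero_le_one) n V.Q
    rw [chainOp_iterate_one] at h
    exact h

/-- The decomposition of the chain at the start of the current cycle. -/
theorem chainOp_iterate_eq_sum (n : ℕ) (φ : V.State → ℝ) :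
    (V.chainOp U)^[n] φ V.Q =
      ∑ s ∈ Finset.range (n + 1), V.renewalProb U s * (V.killedOp U ^ (n - s)) φ V.Q := by
  induction n generalizing φ with
  | zero => simp [renewalProb]
  | succ n ih =>
    -- The killed part lengthens the cycles already begun; the restart part is the new summand, a
    -- cycle beginning at time `n + 1`.
    rw [Function.iterate_succ_apply, chainOp_eq, chainOp_iterate_add, chainOp_iterate_smul,
      Pi.add_apply, ih, Finset.sum_range_succ _ (n + 1), Nat.sub_self]
    congr 1
    · refine Finset.sum_congr rfl fun s hs => ?_
      rw [Nat.succ_sub (Nat.lt_succ_iff.1 (Finset.mem_range.1 hs)), Nat.succ_eq_add_one,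
        killedOp_pow_succ]
    · simp [renewalProb, mul_comm]

theorem tendsto_sum_chainOp_iterate (hU : Summable (V.survival U)) {φ : V.State → ℝ} {F : ℝ}
    (hφ : HasSum (fun n => (V.killedOp U ^ n) φ V.Q) F) :
    Tendsto (fun n : ℕ => (∑ t ∈ Finset.range n, (V.chainOp U)^[t] φ V.Q) / n) atTop
      (𝓝 (F / ∑' n, V.survival U n)) := by
  simp only [chainOp_iterate_eq_sum]
  refine tendsto_renewal_reward (f := fun n => (V.killedOp U ^ n) φ V.Q) renewalProb_nonneg
    renewalProb_le_one hU.hasSum ?_ (fun t => ?_) hφ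
  · have := hU.le_tsum 0 fun n _ => survival_nonneg n
    rw [survival_zero] at this
    linarith
  -- Applied to the constant 1, the decomposition is the renewal equation.
  · have := chainOp_iterate_eq_sum (U := U) t 1
    rw [chainOp_iterate_one] at this
    exact this.symm

end Operators

end VendingSystem

namespace VendingSystem

/-! ### From the demand sequence to the operators. -/

section ChainLaw

variable {V : VendingSystem} {U : Set V.State}

instance : IsProbabilityMeasure V.demandLaw :=
  inferInstanceAs (IsProbabilityMeasure (Measure.infinitePi fun _ : ℕ => V.itemLaw.toMeasure))

theorem demandLaw_real_eval (n : ℕ) (a : Fin V.numItems) :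
    V.demandLaw.real {ω | ω n = a} = V.rate a / V.totalRate := by
  have h := Measure.infinitePi_map_eval (fun _ : ℕ => V.itemLaw.toMeasure) n
  have h2 : V.demandLaw {ω | ω n = a} = V.itemLaw.toMeasure {a} := by
    rw [← h, Measure.map_apply (measurable_pi_apply n) (.singleton a)]
    rfl
  rw [measureReal_def, h2, PMF.toMeasure_apply_singleton _ _ (.singleton a)]
  exact ENNReal.toReal_ofReal (V.rate_div_totalRate_pos a).le

/-- Factoring through a finite type makes measurability and integrability automatic. The unused
coordinates are filled with item 0. -/
theorem exists_eq_comp_of_dependsOn {F : (ℕ → Fin V.numItems) → ℝ} {n : ℕ}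
    (hF : DependsOn F (Set.Iio n)) :
    ∃ f : (Finset.range n → Fin V.numItems) → ℝ,
      F = f ∘ fun ω (i : Finset.range n) => ω i := by
  refine ⟨fun y => F fun i => if h : i ∈ Finset.range n then y ⟨i, h⟩ else ⟨0, V.numItems_pos⟩, ?_⟩
  ext ω
  refine hF fun i hi => ?_
  simp [Set.mem_Iio.1 hi]

theorem measurable_of_dependsOn {F : (ℕ → Fin V.numItems) → ℝ} {n : ℕ}
    (hF : DependsOn F (Set.Iio n)) : Measurable F := by
  obtain ⟨f, rfl⟩ := exists_eq_comp_of_dependsOn hF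
  exact (measurable_of_finite f).comp (by fun_prop)

theorem integrable_of_dependsOn {F : (ℕ → Fin V.numItems) → ℝ} {n : ℕ}
    (hF : DependsOn F (Set.Iio n)) : Integrable F V.demandLaw := by
  obtain ⟨f, rfl⟩ := exists_eq_comp_of_dependsOn hF
  refine Integrable.comp_measurable ?_ (by fun_prop)
  have : IsFiniteMeasure (V.demandLaw.map fun ω (i : Finset.range n) => ω i) :=
    Measure.isFiniteMeasure_map _ _
  exact .of_finite

theorem measurableSet_eval_eq (n : ℕ) (a : Fin V.numItems) :
    MeasurableSet {ω : ℕ → Fin V.numItems | ω n = a} :=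
  measurableSet_eq_fun (measurable_pi_apply n) measurable_const

theorem integral_mul_indicator_eval {F : (ℕ → Fin V.numItems) → ℝ} {n : ℕ}
    (hF : DependsOn F (Set.Iio n)) (a : Fin V.numItems) :
    ∫ ω, F ω * Set.indicator {ω | ω n = a} (1 : (ℕ → Fin V.numItems) → ℝ) ω ∂V.demandLaw =
      (∫ ω, F ω ∂V.demandLaw) * (V.rate a / V.totalRate) := by
  have hms := measurableSet_eval_eq n a
  have hind : IndepFun F (Set.indicator {ω | ω n = a} (1 : (ℕ → Fin V.numItems) → ℝ))
      V.demandLaw := by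
    have h := (iIndepFun_infinitePi (P := fun _ : ℕ => V.itemLaw.toMeasure)
      (X := fun _ x => x) fun _ => measurable_id).indepFun_finset (Finset.range n) {n}
        (by simp) (by fun_prop)
    obtain ⟨f, rfl⟩ := exists_eq_comp_of_dependsOn hF
    classical
    have h2 := h.comp (measurable_of_finite f) (measurable_of_finite
      fun y : ({n} : Finset ℕ) → Fin V.numItems =>
        if y ⟨n, Finset.mem_singleton_self n⟩ = a then (1 : ℝ) else 0)
    convert! h2 using 1
    ext ω
    simp [Set.indicator_apply]
  rw [← demandLaw_real_eval n a]
  refine (hind.integral_fun_mul_eq_mul_integral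
    (measurable_of_dependsOn hF).aestronglyMeasurable
    (measurable_one.indicator hms).aestronglyMeasurable).trans ?_
  rw [integral_indicator_one hms]

/-- The demand at time `n` is independent of the demands before time `n`. -/
theorem integral_demand {Φ : Fin V.numItems → (ℕ → Fin V.numItems) → ℝ} {n : ℕ}
    (hΦ : ∀ a, DependsOn (Φ a) (Set.Iio n)) :
    ∫ ω, Φ (ω n) ω ∂V.demandLaw =
      ∫ ω, ∑ a, V.rate a / V.totalRate * Φ a ω ∂V.demandLaw := by
  have h : ∀ ω : ℕ → Fin V.numItems,
      Φ (ω n) ω = ∑ a, Φ a ω * Set.indicator {ω | ω n = a} 1 ω := by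
    intro ω
    rw [Finset.sum_eq_single (ω n)]
    · simp
    · intro b _ hb
      simp [Ne.symm hb]
    · simp
  simp only [h]
  rw [integral_finsetSum, integral_finsetSum]
  · refine Finset.sum_congr rfl fun a _ => ?_
    rw [integral_mul_indicator_eval (hΦ a), integral_const_mul, mul_comm]
  · exact fun a _ => (integrable_of_dependsOn (hΦ a)).const_mul _
  · intro a _
    refine ((integrable_of_dependsOn (hΦ a)).indicator (measurableSet_eval_eq n a)).congr
      (ae_of_all _ fun ω => ?_)
    by_cases hω : ω n = a <;> simp [hω]

theorem chain_succ_of_mem {ω : ℕ → Fin V.numItems} {n : ℕ} (h : V.chain U ω n ∈ U) :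
    V.chain U ω (n + 1) = V.Q := if_pos h

theorem chain_succ_of_notMem {ω : ℕ → Fin V.numItems} {n : ℕ} (h : V.chain U ω n ∉ U) :
    V.chain U ω (n + 1) = V.chain U ω n - Pi.single (ω n) 1 := if_neg h

theorem chain_dependsOn (U : Set V.State) (n : ℕ) :
    DependsOn (fun ω => V.chain U ω n) (Set.Iio n) := by
  induction n with
  | zero => exact fun _ _ _ => rfl
  | succ n ih =>
    intro x y h
    have h1 : V.chain U x n = V.chain U y n := ih fun i hi => h i (Nat.lt_succ_of_lt hi)
    have h2 : x n = y n := h n (Nat.lt_succ_self n)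
    change V.chain U x (n + 1) = V.chain U y (n + 1)
    by_cases hU : V.chain U y n ∈ U
    · rw [chain_succ_of_mem hU, chain_succ_of_mem (by rwa [h1])]
    · rw [chain_succ_of_notMem hU, chain_succ_of_notMem (by rwa [h1]), h1, h2]

/-- Averaging out the last demand replaces `φ` by `chainOp U φ` one step earlier, so the induction
must run over all `φ`. -/
theorem integral_chain (n : ℕ) (φ : V.State → ℝ) :
    ∫ ω, φ (V.chain U ω n) ∂V.demandLaw = (V.chainOp U)^[n] φ V.Q := by
  classical
  induction n generalizing φ with
  | zero => simp [chain]
  | succ n ih =>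
    rw [Function.iterate_succ_apply, ← ih]
    have h := integral_demand (V := V) (n := n) (Φ := fun a ω =>
      if V.chain U ω n ∈ U then φ V.Q else φ (V.chain U ω n - Pi.single a 1))
      (fun a x y hxy => by simp only [chain_dependsOn U n hxy])
    refine Eq.trans (integral_congr_ae (ae_of_all _ fun ω => ?_))
      (h.trans (integral_congr_ae (ae_of_all _ fun ω => ?_)))
    · by_cases hω : V.chain U ω n ∈ U <;> simp [chain, hω]
    · by_cases hω : V.chain U ω n ∈ U
      · simp [chainOp_of_mem _ hω, hω, ← Finset.sum_mul, sum_rate_div_totalRate]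
      · simp [chainOp_of_notMem _ hω, hω, demandStep]

/-- The event that no state of `U` is visited before time `n`. -/
def avoids (V : VendingSystem) (U : Set V.State) (n : ℕ) : Set (ℕ → Fin V.numItems) :=
  {ω | ∀ k < n, V.chain U ω k ∉ U}

theorem avoids_dependsOn (n : ℕ) (φ : V.State → ℝ) :
    DependsOn ((V.avoids U n).indicator fun ω => φ (V.chain U ω n)) (Set.Iio n) := by
  intro x y hxy
  have h : ∀ k ≤ n, V.chain U x k = V.chain U y k := fun k hk =>
    chain_dependsOn U k fun i hi => hxy i (lt_of_lt_of_le hi hk)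
  have hmem : x ∈ V.avoids U n ↔ y ∈ V.avoids U n :=
    forall₂_congr fun k hk => by rw [h k hk.le]
  by_cases hx : x ∈ V.avoids U n
  · rw [Set.indicator_of_mem hx, Set.indicator_of_mem (hmem.1 hx), h n le_rfl]
  · rw [Set.indicator_of_notMem hx, Set.indicator_of_notMem fun hy => hx (hmem.2 hy)]

theorem mem_avoids_succ {n : ℕ} {ω : ℕ → Fin V.numItems} :
    ω ∈ V.avoids U (n + 1) ↔ ω ∈ V.avoids U n ∧ V.chain U ω n ∉ U :=
  Nat.forall_lt_succ_right

theorem integral_avoids (n : ℕ) (φ : V.State → ℝ) :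
    ∫ ω, (V.avoids U n).indicator (fun ω => φ (V.chain U ω n)) ω ∂V.demandLaw =
      (V.killedOp U ^ n) φ V.Q := by
  classical
  induction n generalizing φ with
  | zero => simp [chain, avoids]
  | succ n ih =>
    rw [killedOp_pow_succ, ← ih]
    have h := integral_demand (V := V) (n := n) (Φ := fun a =>
      (V.avoids U n).indicator fun ω => (fun i =>
        if i ∈ U then 0 else φ (i - Pi.single a 1)) (V.chain U ω n))
      (fun a => avoids_dependsOn n (fun i => if i ∈ U then 0 else φ (i - Pi.single a 1)))
    refine Eq.trans (integral_congr_ae (ae_of_all _ fun ω => ?_))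
      (h.trans (integral_congr_ae (ae_of_all _ fun ω => ?_)))
    · by_cases hω : V.chain U ω n ∈ U <;> by_cases hn : ω ∈ V.avoids U n <;>
        simp [chain, hω, hn, mem_avoids_succ]
    · by_cases hω : V.chain U ω n ∈ U <;> by_cases hn : ω ∈ V.avoids U n <;>
        simp [hω, hn, killedOp_of_mem, killedOp_of_notMem, demandStep]

theorem measurableSet_avoids (n : ℕ) : MeasurableSet (V.avoids U n) := by
  have h := measurable_of_dependsOn (avoids_dependsOn (U := U) n 1)
  have h2 : V.avoids U n = (V.avoids U n).indicator (fun ω => (1 : V.State → ℝ) (V.chain U ω n))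
      ⁻¹' {1} := by
    ext ω
    by_cases hω : ω ∈ V.avoids U n <;> simp [hω]
  rw [h2]
  exact h (.singleton 1)

theorem demandLaw_avoids (n : ℕ) :
    V.demandLaw (V.avoids U n) = ENNReal.ofReal (V.survival U n) := by
  rw [survival, ← integral_avoids]
  have h := integral_indicator_one (μ := V.demandLaw) (measurableSet_avoids (U := U) n)
  rw [← ofReal_measureReal, ← h]
  rfl

/-- Layer-cake formula for the hitting time N: the event N > n is `avoids U (n + 1)`. Both sides are
infinite if the set is never entered. -/
theorem stepsToTrigger_eq_tsum (ω : ℕ → Fin V.numItems) :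
    V.stepsToTrigger U ω = ∑' n, (V.avoids U (n + 1)).indicator 1 ω := by
  classical
  by_cases hω : ∃ k, V.chain U ω k ∈ U
  · have hN := Nat.find_spec hω
    have hsteps : V.stepsToTrigger U ω = (Nat.find hω : ℝ≥0∞) := by
      refine le_antisymm (iInf₂_le (Nat.find hω) hN) (le_iInf₂ fun k hk => ?_)
      exact_mod_cast Nat.find_min' hω hk
    have hmem : ∀ n, ω ∈ V.avoids U (n + 1) ↔ n < Nat.find hω := fun n =>
      ⟨fun h => by
        by_contra hn
        exact h _ (by omega) hN,
      fun h k hk => Nat.find_min hω (by omega)⟩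
    rw [hsteps, tsum_eq_sum (s := Finset.range (Nat.find hω)) fun n hn =>
      Set.indicator_of_notMem (by simpa [hmem] using hn) _,
      Finset.sum_congr rfl fun n hn =>
        Set.indicator_of_mem ((hmem n).2 (Finset.mem_range.1 hn)) _]
    simp
  · have hmem : ∀ n, ω ∈ V.avoids U n := fun n k _ h => hω ⟨k, h⟩
    have hsteps : V.stepsToTrigger U ω = ∞ := by
      simp only [stepsToTrigger, iInf_eq_top]
      exact fun k hk => absurd ⟨k, hk⟩ hω
    simp [hsteps, hmem]

theorem lintegral_stepsToTrigger :
    ∫⁻ ω, V.stepsToTrigger U ω ∂V.demandLaw = ∑' n, ENNReal.ofReal (V.survival U (n + 1)) := by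
  simp only [stepsToTrigger_eq_tsum]
  rw [lintegral_tsum fun n => (measurable_one.indicator (measurableSet_avoids _)).aemeasurable]
  simp only [lintegral_indicator_one (measurableSet_avoids _), demandLaw_avoids]

theorem lintegral_stepsToTrigger_lt_top_iff :
    ∫⁻ ω, V.stepsToTrigger U ω ∂V.demandLaw < ∞ ↔ Summable (V.survival U) := by
  rw [lintegral_stepsToTrigger, ← summable_nat_add_iff 1, lt_top_iff_ne_top]
  constructor
  · intro h
    have := ENNReal.summable_toReal h
    simpa only [ENNReal.toReal_ofReal (survival_nonneg _)] using this
  · intro h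
    exact h.tsum_ofReal_ne_top

theorem Admissible.summable_survival (hU : V.Admissible U) : Summable (V.survival U) :=
  lintegral_stepsToTrigger_lt_top_iff.1 hU.lintegral_steps_lt_top

theorem integral_sum_range_chain (n : ℕ) (φ : V.State → ℝ) :
    ∫ ω, ∑ k ∈ Finset.range n, φ (V.chain U ω k) ∂V.demandLaw =
      ∑ k ∈ Finset.range n, (V.chainOp U)^[k] φ V.Q := by
  rw [integral_finsetSum]
  · simp only [integral_chain]
  · exact fun k _ => integrable_of_dependsOn (n := k) fun x y hxy => by
      exact congrArg φ (chain_dependsOn U k hxy)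

end ChainLaw

end VendingSystem

namespace VendingSystem

/-! ### Cost and duration of a cycle. -/

section CycleCost

variable {V : VendingSystem} {U : Set V.State}

/-- The mean demand for item `j` during the lead time. -/
noncomputable def leadMean (V : VendingSystem) (j : Fin V.numItems) : ℝ≥0 :=
  Real.toNNReal (V.rate j * V.leadTime)

theorem coe_leadMean (V : VendingSystem) (j : Fin V.numItems) :
    (V.leadMean j : ℝ) = V.rate j * V.leadTime :=
  Real.coe_toNNReal _ (mul_nonneg (V.rate_pos j).le V.leadTime_nonneg)

theorem stopCost_eq (V : VendingSystem) (i : V.State) :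
    V.stopCost i =
      V.fixedCost + ∑ j, V.stockoutCost j * poissonShortage (V.leadMean j) (i j) := rfl

theorem leadDemandTail_eq (V : VendingSystem) (j : Fin V.numItems) (x : ℤ) :
    V.leadDemandTail j x = (poissonMeasure (V.leadMean j)).real {r : ℕ | x ≤ (r : ℤ)} := rfl

theorem leadDemandTail_nonneg (j : Fin V.numItems) (x : ℤ) : 0 ≤ V.leadDemandTail j x :=
  measureReal_nonneg

theorem leadDemandTail_le_one (j : Fin V.numItems) (x : ℤ) : V.leadDemandTail j x ≤ 1 := by
  rw [leadDemandTail_eq]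
  exact measureReal_le_one

theorem leadDemandTail_antitone (j : Fin V.numItems) : Antitone (V.leadDemandTail j) := by
  intro x y hxy
  rw [leadDemandTail_eq, leadDemandTail_eq]
  exact measureReal_mono fun r hr => hxy.trans hr

theorem rate_mul_stockoutCost_nonneg (V : VendingSystem) (j : Fin V.numItems) :
    0 ≤ V.rate j * V.stockoutCost j := mul_nonneg (V.rate_pos j).le (V.stockoutCost_nonneg j)

/-- The largest value of `gHat`, attained when all items are sold out. -/
noncomputable def gHatMax (V : VendingSystem) : ℝ := ∑ j, V.rate j * V.stockoutCost j

theorem gHat_nonneg (i : V.State) : 0 ≤ V.gHat i :=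
  Finset.sum_nonneg fun j _ =>
    mul_nonneg (V.rate_mul_stockoutCost_nonneg j) (leadDemandTail_nonneg _ _)

theorem gHat_le_gHatMax (i : V.State) : V.gHat i ≤ V.gHatMax :=
  Finset.sum_le_sum fun j _ =>
    mul_le_of_le_one_right (V.rate_mul_stockoutCost_nonneg j) (leadDemandTail_le_one _ _)

theorem gHat_antitone : Antitone V.gHat := fun _ _ h =>
  Finset.sum_le_sum fun j _ =>
    mul_le_mul_of_nonneg_left (leadDemandTail_antitone j (h j)) (V.rate_mul_stockoutCost_nonneg j)

theorem gHat_of_nonpos {i : V.State} (h : ∀ j, i j ≤ 0) : V.gHat i = V.gHatMax := by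
  simp only [gHat, gHatMax, leadDemandTail_eq, poissonMeasure_tail_of_nonpos _ (h _), mul_one]

theorem sub_single_le (i : V.State) (j : Fin V.numItems) : i - Pi.single j 1 ≤ i :=
  sub_le_self _ (Pi.single_nonneg.2 zero_le_one)

theorem sum_apply_sub_single (f : Fin V.numItems → ℤ → ℝ) (i : V.State) (j : Fin V.numItems) :
    ∑ k, f k ((i - Pi.single j 1 : V.State) k) - ∑ k, f k (i k) = f j (i j - 1) - f j (i j) := by
  rw [← Finset.sum_sub_distrib, Finset.sum_eq_single j]
  · simp
  · intro k _ hk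
    simp [hk]
  · simp

theorem drift_eq_sum (φ : V.State → ℝ) (i : V.State) :
    V.drift φ i = ∑ j, V.rate j / V.totalRate * (φ (i - Pi.single j 1) - φ i) := by
  simp only [mul_sub, Finset.sum_sub_distrib, ← Finset.sum_mul, sum_rate_div_totalRate, one_mul]
  rfl

theorem stopCost_sub_single (i : V.State) (j : Fin V.numItems) :
    V.stopCost (i - Pi.single j 1) - V.stopCost i =
      V.stockoutCost j * V.leadDemandTail j (i j) := by
  rw [stopCost_eq, stopCost_eq, add_sub_add_left_eq_sub,
    sum_apply_sub_single fun k x => V.stockoutCost k * poissonShortage (V.leadMean k) x,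
    poissonShortage_sub_one, leadDemandTail_eq]
  ring

theorem stockoutCost_le_sum (j : Fin V.numItems) : V.stockoutCost j ≤ ∑ k, V.stockoutCost k :=
  Finset.single_le_sum (fun k _ => V.stockoutCost_nonneg k) (Finset.mem_univ j)

theorem abs_stopCost_sub_single_le (i : V.State) (j : Fin V.numItems) :
    |V.stopCost (i - Pi.single j 1) - V.stopCost i| ≤ ∑ k, V.stockoutCost k := by
  rw [stopCost_sub_single,
    abs_of_nonneg (mul_nonneg (V.stockoutCost_nonneg j) (leadDemandTail_nonneg _ _))]
  exact (mul_le_of_le_one_right (V.stockoutCost_nonneg j) (leadDemandTail_le_one _ _)).trans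
    (stockoutCost_le_sum j)

theorem drift_stopCost : V.drift V.stopCost = V.totalRate⁻¹ • V.gHat := by
  ext i
  simp only [drift_eq_sum, stopCost_sub_single, Pi.smul_apply, smul_eq_mul, gHat, Finset.mul_sum]
  exact Finset.sum_congr rfl fun j _ => by ring

theorem stopCost_nonneg (hA : 0 ≤ V.fixedCost) (i : V.State) : 0 ≤ V.stopCost i := by
  rw [stopCost_eq]
  exact add_nonneg hA (Finset.sum_nonneg fun j _ =>
    mul_nonneg (V.stockoutCost_nonneg j) (poissonShortage_nonneg _ _))

theorem minFixedCost_nonneg (V : VendingSystem) : 0 ≤ V.minFixedCost :=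
  Finset.sum_nonneg fun j _ => mul_nonneg
    (mul_nonneg (V.stockoutCost_nonneg j) (by exact_mod_cast (V.Q_pos j).le))
    (leadDemandTail_nonneg _ _)

/-- This is where `minFixedCost` comes from: A ≥ A_min says exactly that G(Q) ≥ τ `gHat Q`. -/
theorem stopCost_full (V : VendingSystem) :
    V.stopCost V.Q = V.fixedCost - V.minFixedCost + V.leadTime * V.gHat V.Q := by
  rw [stopCost_eq, minFixedCost, gHat]
  have h : ∀ j, V.stockoutCost j * poissonShortage (V.leadMean j) (V.Q j) =
      V.leadTime * (V.rate j * V.stockoutCost j * V.leadDemandTail j (V.Q j)) -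
        V.stockoutCost j * (V.Q j : ℝ) * V.leadDemandTail j (V.Q j + 1) := by
    intro j
    obtain ⟨n, hn⟩ := Int.eq_ofNat_of_zero_le (V.Q_pos j).le
    rw [hn, poissonShortage_natCast, coe_leadMean, leadDemandTail_eq, leadDemandTail_eq]
    push_cast
    ring
  simp only [h, Finset.sum_sub_distrib, Finset.mul_sum]
  ring

/-- The expected total of `gHat` over the states of a cycle in which the policy continues. -/
noncomputable def cycleGHat (V : VendingSystem) (U : Set V.State) : ℝ :=
  ∑' n, (V.killedOp U ^ n) (Uᶜ.indicator V.gHat) V.Q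

/-- The expected number of demands in a cycle. -/
noncomputable def cycleDemands (V : VendingSystem) (U : Set V.State) : ℝ :=
  ∑' n, V.survival U (n + 1)

/-- The expected cost of a cycle. -/
noncomputable def cycleCost (V : VendingSystem) (U : Set V.State) : ℝ :=
  V.stopCost V.Q + V.totalRate⁻¹ * V.cycleGHat U

/-- The expected duration of a cycle. -/
noncomputable def cycleTime (V : VendingSystem) (U : Set V.State) : ℝ :=
  V.leadTime + V.totalRate⁻¹ * V.cycleDemands U

theorem summable_gHat (hU : Summable (V.survival U)) :
    Summable fun n => (V.killedOp U ^ n) (Uᶜ.indicator V.gHat) V.Q :=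
  summable_killedOp_pow hU (B := V.gHatMax) fun i _ => by
    rw [abs_of_nonneg (gHat_nonneg i)]
    exact gHat_le_gHatMax i

theorem hasSum_cycleDemands (hU : Summable (V.survival U)) :
    HasSum (fun n => V.survival U (n + 1)) (V.cycleDemands U) :=
  ((summable_nat_add_iff 1).2 hU).hasSum

theorem indicator_smul (s : Set V.State) (c : ℝ) (φ : V.State → ℝ) :
    s.indicator (c • φ) = c • s.indicator φ := by
  ext i
  by_cases hi : i ∈ s <;> simp [hi]

theorem visitCost_eq : V.visitCost U = U.indicator V.stopCost := by
  classical
  ext i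
  by_cases hi : i ∈ U <;> simp [visitCost, hi]

theorem visitTime_eq : V.visitTime U =
    V.leadTime • U.indicator 1 + V.totalRate⁻¹ • Uᶜ.indicator 1 := by
  classical
  ext i
  by_cases hi : i ∈ U <;> simp [visitTime, hi]

/-- Dynkin's formula for `stopCost`; it justifies the formula that defines `cycleCost`. -/
theorem tendsto_sum_killedOp_pow_stopCost (hU : Summable (V.survival U)) :
    Tendsto (fun n => ∑ m ∈ Finset.range n, (V.killedOp U ^ m) (U.indicator V.stopCost) V.Q)
      atTop (𝓝 (V.cycleCost U)) := by
  have h := tendsto_sum_killedOp_pow_indicator hU abs_stopCost_sub_single_le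
  simp only [drift_stopCost, indicator_smul, map_smul, Pi.smul_apply, smul_eq_mul,
    tsum_mul_left] at h
  exact h

theorem hasSum_visitCost (hA : 0 ≤ V.fixedCost) (hU : Summable (V.survival U)) :
    HasSum (fun n => (V.killedOp U ^ n) (V.visitCost U) V.Q) (V.cycleCost U) := by
  rw [visitCost_eq, hasSum_iff_tendsto_nat_of_nonneg]
  · exact tendsto_sum_killedOp_pow_stopCost hU
  · exact fun n => killedOp_pow_nonneg
      (fun i => Set.indicator_nonneg (fun i _ => stopCost_nonneg hA i) i) n V.Q

theorem hasSum_visitTime (hU : Summable (V.survival U)) :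
    HasSum (fun n => (V.killedOp U ^ n) (V.visitTime U) V.Q) (V.cycleTime U) := by
  -- The differences `survival n - survival (n + 1)` sum to 1: a cycle contains one replenishment.
  have h1 := (hU.hasSum.sub (hasSum_cycleDemands hU)).mul_left V.leadTime
  rw [hU.tsum_eq_zero_add, survival_zero, cycleDemands, add_sub_cancel_right, mul_one] at h1
  refine (h1.add ((hasSum_cycleDemands hU).mul_left V.totalRate⁻¹)).congr_fun fun n => ?_
  have h2 : U.indicator (1 : V.State → ℝ) = 1 - Uᶜ.indicator 1 := by
    rw [eq_sub_iff_add_eq, Set.indicator_self_add_compl]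
  rw [visitTime_eq, h2]
  simp only [map_add, map_smul, map_sub, Pi.add_apply, Pi.smul_apply, Pi.sub_apply, smul_eq_mul,
    survival_succ]
  rfl

theorem one_le_cycleDemands (hU : Summable (V.survival U)) (hQ : V.Q ∉ U) :
    1 ≤ V.cycleDemands U := by
  have h := (hasSum_cycleDemands hU).summable.le_tsum 0 fun n _ => survival_nonneg _
  rw [zero_add, ← zero_add 1, survival_succ, pow_zero, Module.End.one_apply,
    Set.indicator_of_mem (by exact hQ)] at h
  exact h

theorem cycleTime_pos (hU : Summable (V.survival U)) (hQ : V.Q ∉ U) : 0 < V.cycleTime U :=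
  add_pos_of_nonneg_of_pos V.leadTime_nonneg (mul_pos (inv_pos.2 V.totalRate_pos)
    (zero_lt_one.trans_le (one_le_cycleDemands hU hQ)))

/-- Renewal-reward for cost and for time separately; the mean number of visits per cycle cancels in
the quotient. -/
theorem hasAverageCost_of_summable (hA : 0 ≤ V.fixedCost) (hU : Summable (V.survival U))
    (hQ : V.Q ∉ U) : V.HasAverageCost U (V.cycleCost U / V.cycleTime U) := by
  have hM : (∑' n, V.survival U n) ≠ 0 := by
    have := hU.le_tsum 0 fun n _ => survival_nonneg n
    rw [survival_zero] at this
    linarith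
  have h := (tendsto_sum_chainOp_iterate hU (hasSum_visitCost hA hU)).div
    (tendsto_sum_chainOp_iterate hU (hasSum_visitTime hU))
    (div_ne_zero (cycleTime_pos hU hQ).ne' hM)
  rw [div_div_div_cancel_right₀ hM] at h
  refine h.congr' ?_
  filter_upwards [eventually_ne_atTop 0] with n hn
  rw [Pi.div_apply, div_div_div_cancel_right₀ (Nat.cast_ne_zero.2 hn), expectedCost, expectedTime,
    integral_sum_range_chain, integral_sum_range_chain]

theorem Admissible.hasAverageCost (hA : 0 ≤ V.fixedCost) (hU : V.Admissible U) :
    V.HasAverageCost U (V.cycleCost U / V.cycleTime U) :=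
  hasAverageCost_of_summable hA hU.summable_survival hU.full_notMem

theorem Admissible.cycleTime_pos (hU : V.Admissible U) : 0 < V.cycleTime U :=
  VendingSystem.cycleTime_pos hU.summable_survival hU.full_notMem

theorem cycleTime_anti {U' : Set V.State} (h : U ⊆ U') (hU : Summable (V.survival U))
    (hU' : Summable (V.survival U')) : V.cycleTime U' ≤ V.cycleTime U :=
  add_le_add_right (mul_le_mul_of_nonneg_left
    (hasSum_le (fun _ => survival_anti h _) (hasSum_cycleDemands hU') (hasSum_cycleDemands hU))
    (inv_nonneg.2 V.totalRate_pos.le)) _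

end CycleCost

/-! ### The monotone stopping problem and the sell-out policy. -/

section ThresholdPolicies

variable {V : VendingSystem} {U : Set V.State} {α : ℝ}

/-- The expected total of `gHat - α` over the first `n` states of a cycle that starts in `i`, as
long as the policy continues. -/
noncomputable def excess (V : VendingSystem) (U : Set V.State) (α : ℝ) (n : ℕ) (i : V.State) : ℝ :=
  ∑ m ∈ Finset.range n, (V.killedOp U ^ m) (Uᶜ.indicator (V.gHat - α • 1)) i

theorem excess_zero (i : V.State) : V.excess U α 0 i = 0 := by simp [excess]

theorem excess_succ (n : ℕ) (i : V.State) :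
    V.excess U α (n + 1) i =
      Uᶜ.indicator (V.gHat - α • 1) i + V.killedOp U (V.excess U α n) i := by
  have h : V.excess U α n =
      ∑ m ∈ Finset.range n, (V.killedOp U ^ m) (Uᶜ.indicator (V.gHat - α • 1)) := by
    ext i
    simp [excess]
  rw [h, map_sum, Finset.sum_apply, excess, Finset.sum_range_succ', add_comm]
  simp [killedOp_pow_succ']

theorem excess_succ_of_mem (n : ℕ) {i : V.State} (hi : i ∈ U) : V.excess U α (n + 1) i = 0 := by
  simp [excess_succ, hi, killedOp_of_mem]

theorem excess_succ_of_notMem (n : ℕ) {i : V.State} (hi : i ∉ U) :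
    V.excess U α (n + 1) i = V.gHat i - α + V.demandStep (V.excess U α n) i := by
  simp [excess_succ, hi, killedOp_of_notMem]

theorem demandStep_nonneg {φ : V.State → ℝ} {i : V.State}
    (h : ∀ j, 0 ≤ φ (i - Pi.single j 1)) : 0 ≤ V.demandStep φ i :=
  Finset.sum_nonneg fun j _ => mul_nonneg (V.rate_div_totalRate_pos j).le (h j)

theorem demandStep_nonpos {φ : V.State → ℝ} {i : V.State}
    (h : ∀ j, φ (i - Pi.single j 1) ≤ 0) : V.demandStep φ i ≤ 0 :=
  Finset.sum_nonpos fun j _ => mul_nonpos_of_nonneg_of_nonpos (V.rate_div_totalRate_pos j).le (h j)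

/-- Demands only increase `gHat`, so once it has reached `α` no later term is negative, whatever `U`
is. -/
theorem excess_nonneg (n : ℕ) {i : V.State} (hi : α ≤ V.gHat i) : 0 ≤ V.excess U α n i := by
  induction n generalizing i with
  | zero => rw [excess_zero]
  | succ n ih =>
    by_cases hU : i ∈ U
    · rw [excess_succ_of_mem n hU]
    · rw [excess_succ_of_notMem n hU]
      exact add_nonneg (sub_nonneg.2 hi)
        (demandStep_nonneg fun j => ih (hi.trans (gHat_antitone (sub_single_le i j))))

theorem sub_single_mem_stateSpace {i : V.State} (hi : i ∈ V.stateSpace) (j : Fin V.numItems) :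
    i - Pi.single j 1 ∈ V.stateSpace := fun k => (sub_single_le i j k).trans (hi k)

theorem excess_onlineTriggerSet_nonpos (n : ℕ) {i : V.State} (hi : i ∈ V.stateSpace) :
    V.excess (V.onlineTriggerSet α) α n i ≤ 0 := by
  induction n generalizing i with
  | zero => rw [excess_zero]
  | succ n ih =>
    by_cases hU : i ∈ V.onlineTriggerSet α
    · rw [excess_succ_of_mem n hU]
    · rw [excess_succ_of_notMem n hU]
      have : V.gHat i ≤ α := not_lt.1 fun h => hU ⟨hi, h⟩
      exact add_nonpos (sub_nonpos.2 this)
        (demandStep_nonpos fun j => ih (sub_single_mem_stateSpace hi j))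

/-- The monotone structure of the stopping problem: the threshold rule minimizes the excess. -/
theorem excess_onlineTriggerSet_le (n : ℕ) {i : V.State} (hi : i ∈ V.stateSpace) :
    V.excess (V.onlineTriggerSet α) α n i ≤ V.excess U α n i := by
  induction n generalizing i with
  | zero => rw [excess_zero, excess_zero]
  | succ n ih =>
    -- Where the threshold rule stops, continuing cannot help; where only `U` stops, the rule
    -- collects a nonpositive sum; where both continue, the current terms agree.
    by_cases hα : i ∈ V.onlineTriggerSet α
    · rw [excess_succ_of_mem n hα]
      exact excess_nonneg _ hα.2.le
    · by_cases hU : i ∈ U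
      · rw [excess_succ_of_mem n hU]
        exact excess_onlineTriggerSet_nonpos _ hi
      · rw [excess_succ_of_notMem n hα, excess_succ_of_notMem n hU]
        exact add_le_add_right
          (demandStep_mono fun j => ih (sub_single_mem_stateSpace hi j)) _

theorem full_mem_stateSpace (V : VendingSystem) : V.Q ∈ V.stateSpace := fun _ => le_rfl

theorem tendsto_excess (hU : Summable (V.survival U)) (α : ℝ) :
    Tendsto (fun n => V.excess U α n V.Q) atTop (𝓝 (V.cycleGHat U - α * V.cycleDemands U)) := by
  refine (((summable_gHat hU).hasSum.sub
    ((hasSum_cycleDemands hU).mul_left α)).tendsto_sum_nat).congr fun n => ?_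
  refine Finset.sum_congr rfl fun m _ => ?_
  have h : Uᶜ.indicator (V.gHat - α • 1) =
      Uᶜ.indicator V.gHat - α • Uᶜ.indicator (1 : V.State → ℝ) := by
    ext i
    by_cases hi : i ∈ U <;> simp [hi]
  rw [h, survival_succ]
  simp only [map_sub, map_smul, Pi.sub_apply, Pi.smul_apply, smul_eq_mul]

theorem cycleCost_sub (U : Set V.State) (α : ℝ) :
    V.cycleCost U - α * V.cycleTime U = V.stopCost V.Q - α * V.leadTime +
      V.totalRate⁻¹ * (V.cycleGHat U - α * V.cycleDemands U) := by
  rw [cycleCost, cycleTime]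
  ring

theorem cycleCost_onlineTriggerSet_sub_le (hα : Summable (V.survival (V.onlineTriggerSet α)))
    (hU : Summable (V.survival U)) :
    V.cycleCost (V.onlineTriggerSet α) - α * V.cycleTime (V.onlineTriggerSet α) ≤
      V.cycleCost U - α * V.cycleTime U := by
  rw [cycleCost_sub, cycleCost_sub]
  exact add_le_add_right (mul_le_mul_of_nonneg_left
    (le_of_tendsto_of_tendsto' (tendsto_excess hα α) (tendsto_excess hU α)
      fun n => excess_onlineTriggerSet_le n V.full_mem_stateSpace)
    (inv_nonneg.2 V.totalRate_pos.le)) _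

/-- At level `gHat Q` the excess from `Q` is nonnegative, and so is G(Q) - τ `gHat Q`. -/
theorem gHat_full_le_div (hmin : V.minFixedCost ≤ V.fixedCost) (hU : V.Admissible U) :
    V.gHat V.Q ≤ V.cycleCost U / V.cycleTime U := by
  rw [le_div_iff₀ hU.cycleTime_pos, ← sub_nonneg, cycleCost_sub, stopCost_full]
  have h := ge_of_tendsto' (tendsto_excess hU.summable_survival (V.gHat V.Q))
    fun n => excess_nonneg n le_rfl
  have h2 := mul_nonneg (inv_nonneg.2 V.totalRate_pos.le) h
  linarith

/-- The states in which all items are sold out. -/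
def soldOutSet (V : VendingSystem) : Set V.State := {i | i ∈ V.stateSpace ∧ ∀ j, i j ≤ 0}

theorem exists_pos_of_notMem_soldOutSet {i : V.State} (hi : i ∉ V.soldOutSet) : ∃ j, 0 < i j := by
  by_contra! h
  exact hi ⟨fun j => (h j).trans (V.Q_pos j).le, h⟩

theorem full_notMem_soldOutSet (V : VendingSystem) : V.Q ∉ V.soldOutSet := fun h =>
  (h.2 ⟨0, V.numItems_pos⟩).not_gt (V.Q_pos _)

/-- A Lyapunov function for the time until all items are sold out. -/
noncomputable def soldOutBound (V : VendingSystem) (i : V.State) : ℝ :=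
  ∑ j, (V.rate j / V.totalRate)⁻¹ * (max (i j) 0 : ℤ)

theorem soldOutBound_nonneg : 0 ≤ V.soldOutBound := fun _ =>
  Finset.sum_nonneg fun j _ => mul_nonneg (inv_nonneg.2 (V.rate_div_totalRate_pos j).le)
    (Int.cast_nonneg (le_max_right _ _))

/-- The inverse-probability weights cancel the demand probabilities, so each item still in stock
contributes -1. -/
theorem drift_soldOutBound_le {i : V.State} (hi : i ∉ V.soldOutSet) :
    V.drift V.soldOutBound i ≤ -1 := by
  obtain ⟨j, hj⟩ := exists_pos_of_notMem_soldOutSet hi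
  have h : ∀ k, V.rate k / V.totalRate *
      (V.soldOutBound (i - Pi.single k 1) - V.soldOutBound i) =
        ((max (i k - 1) 0 - max (i k) 0 : ℤ) : ℝ) := by
    intro k
    rw [soldOutBound, soldOutBound, sum_apply_sub_single fun k x =>
      (V.rate k / V.totalRate)⁻¹ * ((max x 0 : ℤ) : ℝ), ← mul_sub,
      mul_inv_cancel_left₀ (V.rate_div_totalRate_pos k).ne', ← Int.cast_sub]
  rw [drift_eq_sum, Finset.sum_congr rfl fun k _ => h k, ← Int.cast_sum]
  have h2 : ∑ k, (max (i k - 1) 0 - max (i k) 0) ≤ max (i j - 1) 0 - max (i j) 0 := by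
    rw [← Finset.add_sum_erase _ _ (Finset.mem_univ j)]
    refine add_le_of_nonpos_right (Finset.sum_nonpos fun k _ => ?_)
    omega
  have h3 : ∑ k, (max (i k - 1) 0 - max (i k) 0) ≤ -1 := h2.trans (by omega)
  exact_mod_cast h3

/-- Foster's criterion: drift at most -1 lets the survival probabilities be summed by telescoping
`soldOutBound`. -/
theorem summable_survival_soldOutSet (V : VendingSystem) :
    Summable (V.survival V.soldOutSet) := by
  rw [← summable_nat_add_iff 1]
  have hle : V.soldOutSetᶜ.indicator 1 ≤
      V.soldOutBound - V.killedOp V.soldOutSet V.soldOutBound := by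
    intro i
    by_cases hi : i ∈ V.soldOutSet
    · simpa [hi, killedOp_of_mem] using soldOutBound_nonneg i
    · have := drift_soldOutBound_le hi
      rw [drift] at this
      rw [Set.indicator_of_mem (by exact hi), Pi.sub_apply, killedOp_of_notMem _ hi, Pi.one_apply]
      linarith
  refine summable_of_sum_range_le (c := V.soldOutBound V.Q) (fun n => survival_nonneg _) fun n => ?_
  have h : ∀ m, V.survival V.soldOutSet (m + 1) ≤
      (V.killedOp V.soldOutSet ^ m) V.soldOutBound V.Q -
        (V.killedOp V.soldOutSet ^ (m + 1)) V.soldOutBound V.Q := by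
    intro m
    rw [survival_succ, killedOp_pow_succ, ← Pi.sub_apply, ← map_sub]
    exact killedOp_pow_mono hle m V.Q
  refine (Finset.sum_le_sum fun m _ => h m).trans ?_
  rw [Finset.sum_range_sub']
  exact sub_le_self _ (killedOp_pow_nonneg soldOutBound_nonneg n V.Q)

theorem admissible_of_soldOutSet_subset (h : V.soldOutSet ⊆ U) (hS : U ⊆ V.stateSpace)
    (hQ : V.Q ∉ U) : V.Admissible U where
  subset_stateSpace := hS
  full_notMem := hQ
  lintegral_steps_lt_top := lintegral_stepsToTrigger_lt_top_iff.2
    (Summable.of_nonneg_of_le survival_nonneg (survival_anti h) V.summable_survival_soldOutSet)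

theorem admissible_soldOutSet (V : VendingSystem) : V.Admissible V.soldOutSet :=
  admissible_of_soldOutSet_subset le_rfl (fun _ h => h.1) V.full_notMem_soldOutSet

theorem soldOutSet_subset_onlineTriggerSet (h : α < V.gHatMax) :
    V.soldOutSet ⊆ V.onlineTriggerSet α := fun i hi => ⟨hi.1, by rwa [gHat_of_nonpos hi.2]⟩

theorem admissible_onlineTriggerSet (hQ : V.gHat V.Q ≤ α) (h : α < V.gHatMax) :
    V.Admissible (V.onlineTriggerSet α) :=
  admissible_of_soldOutSet_subset (soldOutSet_subset_onlineTriggerSet h) (fun _ hi => hi.1)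
    fun hi => hi.2.not_ge hQ

/-- The affine function of the state that agrees with `stopCost` when all items are sold out. -/
noncomputable def soldOutCost (V : VendingSystem) (i : V.State) : ℝ :=
  V.fixedCost + ∑ j, V.stockoutCost j * (V.leadMean j - i j)

theorem soldOutCost_sub_single (i : V.State) (j : Fin V.numItems) :
    V.soldOutCost (i - Pi.single j 1) - V.soldOutCost i = V.stockoutCost j := by
  rw [soldOutCost, soldOutCost, add_sub_add_left_eq_sub,
    sum_apply_sub_single fun k x => V.stockoutCost k * ((V.leadMean k : ℝ) - (x : ℝ))]
  push_cast
  ring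

theorem drift_soldOutCost : V.drift V.soldOutCost = (V.totalRate⁻¹ * V.gHatMax) • 1 := by
  ext i
  simp only [drift_eq_sum, soldOutCost_sub_single, Pi.smul_apply, Pi.one_apply, smul_eq_mul,
    gHatMax, Finset.mul_sum, mul_one]
  exact Finset.sum_congr rfl fun j _ => by ring

theorem indicator_soldOutSet_stopCost :
    V.soldOutSet.indicator V.stopCost = V.soldOutSet.indicator V.soldOutCost := by
  refine Set.indicator_congr fun i hi => ?_
  simp only [stopCost_eq, soldOutCost, poissonShortage_of_nonpos _ (hi.2 _)]

theorem soldOutCost_full (V : VendingSystem) :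
    V.soldOutCost V.Q = V.fixedCost - V.fullLoadValue + V.gHatMax * V.leadTime := by
  simp only [soldOutCost, fullLoadValue, gHatMax, mul_sub, Finset.sum_sub_distrib, coe_leadMean,
    Finset.sum_mul]
  rw [Finset.sum_congr rfl fun j _ => show V.stockoutCost j * (V.rate j * V.leadTime) =
    V.rate j * V.stockoutCost j * V.leadTime by ring]
  ring

/-- A cycle that stops only when all is sold out loses all its demand except one full load.
Formally, `stopCost` agrees at the stop with an affine function of constant drift, to which Dynkin's
formula applies. -/
theorem cycleCost_soldOutSet (V : VendingSystem) :
    V.cycleCost V.soldOutSet =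
      V.fixedCost - V.fullLoadValue + V.gHatMax * V.cycleTime V.soldOutSet := by
  have hU := V.summable_survival_soldOutSet
  have h1 := tendsto_sum_killedOp_pow_stopCost hU
  have h2 := tendsto_sum_killedOp_pow_indicator hU (φ := V.soldOutCost)
    (B := ∑ k, V.stockoutCost k) fun i j => by
      rw [soldOutCost_sub_single, abs_of_nonneg (V.stockoutCost_nonneg j)]
      exact stockoutCost_le_sum j
  rw [indicator_soldOutSet_stopCost] at h1
  rw [tendsto_nhds_unique h1 h2, soldOutCost_full, drift_soldOutCost, cycleTime]
  simp only [indicator_smul, map_smul, Pi.smul_apply, smul_eq_mul, tsum_mul_left, ← survival_succ]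
  rw [← cycleDemands]
  ring

theorem cycleCost_soldOutSet_div_lt (hmax : V.fixedCost < V.fullLoadValue) :
    V.cycleCost V.soldOutSet / V.cycleTime V.soldOutSet < V.gHatMax := by
  rw [div_lt_iff₀ V.admissible_soldOutSet.cycleTime_pos, cycleCost_soldOutSet]
  linarith

end ThresholdPolicies

/-! ### Attainment of the infimum. -/

section Optimality

variable {V : VendingSystem} {U : Set V.State}

theorem optimalCost_le (hmin : V.minFixedCost ≤ V.fixedCost) (hU : V.Admissible U) :
    V.optimalCost ≤ V.cycleCost U / V.cycleTime U := by
  have hA := V.minFixedCost_nonneg.trans hmin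
  refine csInf_le ⟨V.gHat V.Q, ?_⟩ ⟨U, hU, hU.hasAverageCost hA⟩
  rintro c ⟨U', hU', hc⟩
  rw [tendsto_nhds_unique hc (hU'.hasAverageCost hA)]
  exact gHat_full_le_div hmin hU'

theorem gHat_full_le_optimalCost (hmin : V.minFixedCost ≤ V.fixedCost) :
    V.gHat V.Q ≤ V.optimalCost := by
  have hA := V.minFixedCost_nonneg.trans hmin
  refine le_csInf ⟨_, V.soldOutSet, V.admissible_soldOutSet,
    V.admissible_soldOutSet.hasAverageCost hA⟩ ?_
  rintro c ⟨U', hU', hc⟩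
  rw [tendsto_nhds_unique hc (hU'.hasAverageCost hA)]
  exact gHat_full_le_div hmin hU'

theorem exists_admissible_of_optimalCost_lt (hmin : V.minFixedCost ≤ V.fixedCost) {α : ℝ}
    (hα : V.optimalCost < α) :
    ∃ U, V.Admissible U ∧ V.cycleCost U - α * V.cycleTime U < 0 := by
  have hA := V.minFixedCost_nonneg.trans hmin
  obtain ⟨c, ⟨U, hU, hc⟩, hcα⟩ := exists_lt_of_csInf_lt
    (s := {c | ∃ U, V.Admissible U ∧ V.HasAverageCost U c})
    ⟨_, V.soldOutSet, V.admissible_soldOutSet, V.admissible_soldOutSet.hasAverageCost hA⟩ hα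
  rw [tendsto_nhds_unique hc (hU.hasAverageCost hA), div_lt_iff₀ hU.cycleTime_pos] at hcα
  exact ⟨U, hU, sub_neg.2 hcα⟩

theorem optimalCost_lt_gHatMax (hmin : V.minFixedCost ≤ V.fixedCost)
    (hmax : V.fixedCost < V.fullLoadValue) : V.optimalCost < V.gHatMax :=
  (optimalCost_le hmin V.admissible_soldOutSet).trans_lt (cycleCost_soldOutSet_div_lt hmax)

/-- At level α* the α*-rule does no worse than the α-rule, and at level α the latter is negative.
Changing the level costs (α - α*) times its cycle time, bounded uniformly by the sell-out time. -/
theorem cycleCost_optimal_sub_lt (hmin : V.minFixedCost ≤ V.fixedCost)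
    (hmax : V.fixedCost < V.fullLoadValue) {α : ℝ} (hα : V.optimalCost < α)
    (hα' : α < V.gHatMax) :
    V.cycleCost (V.onlineTriggerSet V.optimalCost) -
      V.optimalCost * V.cycleTime (V.onlineTriggerSet V.optimalCost) <
        (α - V.optimalCost) * V.cycleTime V.soldOutSet := by
  have hQ := gHat_full_le_optimalCost hmin
  have hopt := (admissible_onlineTriggerSet hQ
    (optimalCost_lt_gHatMax hmin hmax)).summable_survival
  have hadm := (admissible_onlineTriggerSet (hQ.trans hα.le) hα').summable_survival
  obtain ⟨U, hU, hlt⟩ := exists_admissible_of_optimalCost_lt hmin hα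
  have h1 := cycleCost_onlineTriggerSet_sub_le hopt hadm
  have h2 := cycleCost_onlineTriggerSet_sub_le hadm hU.summable_survival
  have h3 := mul_le_mul_of_nonneg_left (cycleTime_anti (soldOutSet_subset_onlineTriggerSet hα')
    V.summable_survival_soldOutSet hadm) (sub_nonneg.2 hα.le)
  linarith

theorem cycleCost_optimal_le (hmin : V.minFixedCost ≤ V.fixedCost)
    (hmax : V.fixedCost < V.fullLoadValue) :
    V.cycleCost (V.onlineTriggerSet V.optimalCost) ≤
      V.optimalCost * V.cycleTime (V.onlineTriggerSet V.optimalCost) := by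
  by_contra! hpos
  have hT := V.admissible_soldOutSet.cycleTime_pos
  have hlt := optimalCost_lt_gHatMax hmin hmax
  -- `δ` keeps α* + δ below `gHatMax` and makes `δ` times the sell-out time smaller than the
  -- supposed positive gap.
  obtain ⟨δ, hδ0, hδ⟩ := exists_between (lt_min (sub_pos.2 hlt) (div_pos (sub_pos.2 hpos) hT))
  have h1 := hδ.trans_le (min_le_left _ _)
  have h2 := (lt_div_iff₀ hT).1 (hδ.trans_le (min_le_right _ _))
  have h3 := cycleCost_optimal_sub_lt hmin hmax (α := V.optimalCost + δ) (by linarith)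
    (by linarith)
  rw [add_sub_cancel_left] at h3
  exact lt_asymm h2 h3

end Optimality

end VendingSystem

theorem theorem2 (V : VendingSystem)
    (hmin : V.minFixedCost ≤ V.fixedCost) (hmax : V.fixedCost < V.fullLoadValue) :
    -- the policy `μ_{α*}` is admissible and its average cost is `α*`
    V.Admissible (V.onlineTriggerSet V.optimalCost) ∧
    V.HasAverageCost (V.onlineTriggerSet V.optimalCost) V.optimalCost ∧
    -- every admissible trigger set has an average cost, and none is below `α*`
    ∀ U : Set V.State, V.Admissible U →
      ∃ c : ℝ, V.HasAverageCost U c ∧ V.optimalCost ≤ c := by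
  have hA := V.minFixedCost_nonneg.trans hmin
  have hadm := VendingSystem.admissible_onlineTriggerSet
    (VendingSystem.gHat_full_le_optimalCost hmin)
    (VendingSystem.optimalCost_lt_gHatMax hmin hmax)
  refine ⟨hadm, ?_, fun U hU => ⟨_, hU.hasAverageCost hA, VendingSystem.optimalCost_le hmin hU⟩⟩
  have h : V.cycleCost (V.onlineTriggerSet V.optimalCost) /
      V.cycleTime (V.onlineTriggerSet V.optimalCost) = V.optimalCost :=
    le_antisymm ((div_le_iff₀ hadm.cycleTime_pos).2
      (VendingSystem.cycleCost_optimal_le hmin hmax)) (VendingSystem.optimalCost_le hmin hadm)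
  have havg := hadm.hasAverageCost hA
  rwa [h] at havg
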